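/- Throughout, a real algebra is a real vector space $A$ with a bilinear product $A\times A\to A$ (not assumed associative or unital); it is absolute-valued if $A$ carries a norm with $\|xy\|=\|x\|\,\|y\|$ for all $x,y\in A$. Write $(x,y,z)=(xy)z-x(yz)$ and $x^2=xx$. Two real algebras are isomorphic if there is a linear bijection between them that preserves products. Let $\mathbb H$ be the algebra of real quaternions, with conjugation $x\mapsto\overline x$, first imaginary unit $i$, and $e^{i\alpha}=\cos\alpha+(\sin\alpha)\,i$. For norm-one $a,b\in\mathbb H$, let ${}^*\mathbb H(a,b)$, $\mathbb H^*(a,b)$ and $\overset{*}{\mathbb H}$ be the space $\mathbb H$ with the products $$x\odot y=\overline x\,a\,y\,b,\qquad x\odot y=a\,x\,b\,\overline y,\qquad x\odot y=\overline x\,\overline y,$$ respectively. **Theorem.** Let $A$ be a $4$-dimensional absolute-valued real algebra. Then $A$ satisfies the identity $(x^2,x^2,x^2)=0$ for all $x\in A$ if and only if $A$ is isomorphic to one of $$\mathbb H,\quad \overset{*}{\mathbb H},\quad {}^*\mathbb H(i,1),\quad {}^*\mathbb H(i,i),\quad \mathbb H^*(1,i),\quad \mathbb H^*(i,i),$$ $${}^*\mathbb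 H(1,e^{i\alpha}),\quad \mathbb H^*(e^{i\alpha},1)\qquad\text{with }\alpha\in[0,\pi).$$ Moreover, the algebras in this list represent infinitely many isomorphism classes. -/

import Mathlib

open scoped Quaternion

namespace AbsoluteValued

/-- A (real, not necessarily associative or unital) algebra is a real vector space `A` with a
bilinear product `m`. It is absolute valued if the norm of `A` is multiplicative. -/
def IsAbsoluteValued {A : Type*} [NormedAddCommGroup A] [NormedSpace ℝ A]
    (m : A →ₗ[ℝ] A →ₗ[ℝ] A) : Prop :=
  ∀ x y : A, ‖m x y‖ = ‖x‖ * ‖y‖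

/-- The associator `(x, y, z) = (xy)z - x(yz)` of the product `m`. -/
def assoc {A : Type*} [AddCommGroup A] [Module ℝ A]
    (m : A →ₗ[ℝ] A →ₗ[ℝ] A) (x y z : A) : A :=
  m (m x y) z - m x (m y z)

/-- The identity `(x², x², x²) = 0`, where `x² = xx`. -/
def SatisfiesSqSqSq {A : Type*} [AddCommGroup A] [Module ℝ A]
    (m : A →ₗ[ℝ] A →ₗ[ℝ] A) : Prop :=
  ∀ x : A, assoc m (m x x) (m x x) (m x x) = 0

/-- Isomorphism of real algebras: a linear bijection preserving products. -/
def Isomorphic {A B : Type*} [AddCommGroup A] [Module ℝ A] [AddCommGroup B] [Module ℝ B]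
    (m : A →ₗ[ℝ] A →ₗ[ℝ] A) (n : B →ₗ[ℝ] B →ₗ[ℝ] B) : Prop :=
  ∃ f : A ≃ₗ[ℝ] B, ∀ x y : A, f (m x y) = n (f x) (f y)

/-- The product of the algebra `ℍ`. -/
noncomputable def H : ℍ[ℝ] →ₗ[ℝ] ℍ[ℝ] →ₗ[ℝ] ℍ[ℝ] :=
  LinearMap.mk₂ ℝ (fun x y => x * y)
    (by intros; simp [add_mul]) (by intros; simp)
    (by intros; simp [mul_add]) (by intros; simp)

/-- The product of the algebra `*ℍ(a, b)`. -/
noncomputable def starH (a b : ℍ[ℝ]) : ℍ[ℝ] →ₗ[ℝ] ℍ[ℝ] →ₗ[ℝ] ℍ[ℝ] :=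
  LinearMap.mk₂ ℝ (fun x y => star x * a * y * b)
    (by intros; simp [add_mul]) (by intros; simp)
    (by intros; simp [mul_add, add_mul]) (by intros; simp)

/-- The product of the algebra `ℍ*(a, b)`. -/
noncomputable def Hstar (a b : ℍ[ℝ]) : ℍ[ℝ] →ₗ[ℝ] ℍ[ℝ] →ₗ[ℝ] ℍ[ℝ] :=
  LinearMap.mk₂ ℝ (fun x y => a * x * b * star y)
    (by intros; simp [mul_add, add_mul]) (by intros; simp)
    (by intros; simp [mul_add]) (by intros; simp)

/-- The product of the doubly starred algebra `ℍ`. -/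
noncomputable def starHstar : ℍ[ℝ] →ₗ[ℝ] ℍ[ℝ] →ₗ[ℝ] ℍ[ℝ] :=
  LinearMap.mk₂ ℝ (fun x y => star x * star y)
    (by intros; simp [add_mul]) (by intros; simp)
    (by intros; simp [mul_add]) (by intros; simp)

/-- The quaternion unit `i`. -/
def qi : ℍ[ℝ] := ⟨0, 1, 0, 0⟩

/-- The quaternion `e^{iα} = cos α + (sin α) i`. -/
noncomputable def expi (α : ℝ) : ℍ[ℝ] := ⟨Real.cos α, Real.sin α, 0, 0⟩

/-- The list of algebras, as a set of products on the space `ℍ`. -/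
def algebraList : Set (ℍ[ℝ] →ₗ[ℝ] ℍ[ℝ] →ₗ[ℝ] ℍ[ℝ]) :=
  {H, starHstar, starH qi 1, starH qi qi, Hstar 1 qi, Hstar qi qi} ∪
    {m | ∃ α ∈ Set.Ico (0 : ℝ) Real.pi, m = starH 1 (expi α) ∨ m = Hstar (expi α) 1}

/-- Isomorphism, as an equivalence relation on the algebra structures on a fixed space. -/
def isoSetoid (A : Type*) [AddCommGroup A] [Module ℝ A] :
    Setoid (A →ₗ[ℝ] A →ₗ[ℝ] A) where
  r m n := Isomorphic m n
  iseqv :=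
    { refl := fun _ => ⟨LinearEquiv.refl ℝ A, fun _ _ => rfl⟩
      symm := by
        rintro m n ⟨f, hf⟩
        exact ⟨f.symm, fun x y => by
          rw [LinearEquiv.symm_apply_eq, hf, f.apply_symm_apply, f.apply_symm_apply]⟩
      trans := by
        rintro m n k ⟨f, hf⟩ ⟨g, hg⟩
        exact ⟨f.trans g, fun x y => by simp [hf, hg]⟩ }

/-- The isomorphism class of an algebra structure on `A`. -/
def isoClass {A : Type*} [AddCommGroup A] [Module ℝ A] (m : A →ₗ[ℝ] A →ₗ[ℝ] A) :
    Quotient (isoSetoid A) :=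
  Quotient.mk (isoSetoid A) m

end AbsoluteValued

open scoped Quaternion

namespace AbsoluteValued

open MeasureTheory

/-! ### The norm is Euclidean. -/

section Euclidean
variable {A : Type*} [NormedAddCommGroup A] [NormedSpace ℝ A] {m : A →ₗ[ℝ] A →ₗ[ℝ] A}

/-! Multiplication by a norm-one element is an isometry. Averaging a Euclidean form over the unit
ball therefore shows that the norm is Euclidean, and the algebra may be placed on ℍ
(`exists_quaternion`). Kaplansky's trick passes to an isotope with unit 1, which in dimension four
is ℍ or its opposite (`eq_mul_or_flip`). So the product is `S x * T y` or `T y * S x` with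
isometries S, T. By Cartan–Dieudonné each isometry is p x q or p x̄ q, and absorbing units leaves
four shapes: a x y b, x̄ a y b, a x b ȳ, a x̄ ȳ b (`exists_principal`).

In the first and last shapes every quaternion is a square of the algebra, so the identity becomes
third-power associativity and forces a, b = ±1. In the second, the squares of norm-one elements are
cb with c conjugate to a. Conjugating a into ℂ and testing suitable c gives a = ±1 with b arbitrary,
or a = i with b ∈ {±1, ±i}; signs and conjugation then reduce to the list. The third shape is
opposite to the second.

The algebras *ℍ(1, e^{iα}) are separated by the trace 4cos²α of left multiplication by their only
nonzero idempotent. -/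

/-- Right multiplication by a norm-one element of a finite-dimensional absolute-valued algebra,
as a linear isometry equivalence. -/
noncomputable def IsAbsoluteValued.right [FiniteDimensional ℝ A] (h : IsAbsoluteValued m) (y : A)
    (hy : ‖y‖ = 1) : A ≃ₗᵢ[ℝ] A :=
  LinearIsometry.toLinearIsometryEquiv ⟨m.flip y, fun x => by simp [h x y, hy]⟩ rfl

/-- Left multiplication by a norm-one element. -/
noncomputable def IsAbsoluteValued.left [FiniteDimensional ℝ A] (h : IsAbsoluteValued m) (x : A)
    (hx : ‖x‖ = 1) : A ≃ₗᵢ[ℝ] A :=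
  LinearIsometry.toLinearIsometryEquiv ⟨m x, fun y => by simp [h x y, hx]⟩ rfl

/-- The norm of a finite-dimensional absolute-valued algebra comes from an inner product: the
square of a Euclidean norm of `m x y`, averaged over the unit ball in `x`, is a quadratic form
in `y` proportional to `‖y‖ ^ 2`. -/
theorem IsAbsoluteValued.parallelogram [FiniteDimensional ℝ A] (h : IsAbsoluteValued m) (y z : A) :
    ‖y + z‖ * ‖y + z‖ + ‖y - z‖ * ‖y - z‖ = 2 * (‖y‖ * ‖y‖ + ‖z‖ * ‖z‖) := by
  borelize A
  have : ProperSpace A := FiniteDimensional.proper_real A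
  rcases subsingleton_or_nontrivial A with hs | hn
  · simp [Subsingleton.elim y 0, Subsingleton.elim z 0]
  -- Hausdorff measure is invariant under all isometries, with no inner product needed. The map `e`
  -- is any linear isomorphism; it only supplies a quadratic form.
  let μ : Measure A := Measure.hausdorffMeasure (Module.finrank ℝ A)
  let e : A ≃L[ℝ] EuclideanSpace ℝ (Fin (Module.finrank ℝ A)) :=
    ContinuousLinearEquiv.ofFinrankEq (by simp)
  let B : Set A := Metric.closedBall 0 1
  let q : A → ℝ := fun y => ∫ x in B, ‖e (m x y)‖ ^ 2 ∂μ
  let c : ℝ := ∫ x in B, ‖e x‖ ^ 2 ∂μ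
  have hB : IsCompact B := isCompact_closedBall 0 1
  have hcont (y : A) : Continuous fun x => ‖e (m x y)‖ ^ 2 := by
    have : Continuous fun x => m x y := (m.flip y).continuous_of_finiteDimensional
    fun_prop
  have hint (y : A) : IntegrableOn (fun x => ‖e (m x y)‖ ^ 2) B μ :=
    (hcont y).continuousOn.integrableOn_compact hB
  have hq1 (y : A) (hy : ‖y‖ = 1) : q y = c := by
    have hmp := (h.right y hy).toIsometryEquiv.measurePreserving_hausdorffMeasure
      (Module.finrank ℝ A : ℝ)
    have := hmp.setIntegral_preimage_emb
      (h.right y hy).toHomeomorph.measurableEmbedding (fun x => ‖e x‖ ^ 2) B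
    have hpre : (h.right y hy).toIsometryEquiv ⁻¹' B = B := by
      ext x; simp [B]
    rw [hpre] at this
    exact this
  have hsmul (t : ℝ) (y : A) : q (t • y) = t ^ 2 * q y := by
    simp only [q, map_smul, norm_smul, mul_pow, Real.norm_eq_abs, sq_abs]
    rw [integral_const_mul]
  have hq (y : A) : q y = c * (‖y‖ * ‖y‖) := by
    rcases eq_or_ne y 0 with rfl | hy
    · simp [q]
    · have h1 : ‖‖y‖⁻¹ • y‖ = 1 := by
        rw [norm_smul, norm_inv, norm_norm, inv_mul_cancel₀ (norm_ne_zero_iff.2 hy)]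
      have h2 := hq1 _ h1
      rw [hsmul] at h2
      have := norm_ne_zero_iff.2 hy
      rw [← h2]; field_simp
  have hc : c ≠ 0 := by
    have hpos : 0 < c := by
      refine (setIntegral_pos_iff_support_of_nonneg_ae ?_ ?_).2 ?_
      · exact Filter.Eventually.of_forall fun x => by positivity
      · exact (by fun_prop : Continuous fun x => ‖e x‖ ^ 2).continuousOn.integrableOn_compact hB
      · obtain ⟨v, hv⟩ := exists_ne (0 : A)
        have hU : IsOpen ({0}ᶜ ∩ Metric.ball (0 : A) 1) :=
          isOpen_compl_singleton.inter Metric.isOpen_ball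
        have hne : ({0}ᶜ ∩ Metric.ball (0 : A) 1).Nonempty := by
          refine ⟨(2 * ‖v‖)⁻¹ • v, ?_, ?_⟩
          · simp [hv]
          · have := norm_ne_zero_iff.2 hv
            simp only [mem_ball_zero_iff, norm_smul, norm_inv, norm_mul, norm_norm]
            norm_num; field_simp; norm_num
        refine lt_of_lt_of_le (hU.measure_pos μ hne) (measure_mono ?_)
        rintro x ⟨hx, hx'⟩
        refine ⟨by simpa using hx, Metric.ball_subset_closedBall hx'⟩
    exact hpos.ne'
  have hpar : q (y + z) + q (y - z) = 2 * (q y + q z) := by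
    simp only [q]
    rw [← integral_add (hint _) (hint _), ← integral_add (hint _) (hint _), ← integral_const_mul]
    congr 1; ext x
    have := parallelogram_law_with_norm ℝ (e (m x y)) (e (m x z))
    simp only [map_add, map_sub]
    linarith
  rw [hq, hq, hq, hq] at hpar
  refine mul_left_cancel₀ hc ?_
  linarith

/-- A four-dimensional absolute-valued algebra is isometrically isomorphic to an absolute-valued
algebra on the space of quaternions. -/
theorem IsAbsoluteValued.exists_quaternion (h : IsAbsoluteValued m)
    (hd : Module.finrank ℝ A = 4) :
    ∃ n : ℍ[ℝ] →ₗ[ℝ] ℍ[ℝ] →ₗ[ℝ] ℍ[ℝ], IsAbsoluteValued n ∧ Isomorphic m n := by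
  have : FiniteDimensional ℝ A := Module.finite_of_finrank_pos (by omega)
  let _ : InnerProductSpace ℝ A := InnerProductSpace.ofNorm ℝ h.parallelogram
  let e : A ≃ₗᵢ[ℝ] ℍ[ℝ] := (stdOrthonormalBasis ℝ A).equiv
    (stdOrthonormalBasis ℝ ℍ[ℝ]) (finCongr (hd.trans Quaternion.finrank_eq_four.symm))
  refine ⟨LinearMap.mk₂ ℝ (fun x y => e (m (e.symm x) (e.symm y))) (by simp) (by simp) (by simp)
    (by simp), fun x y => ?_, e.toLinearEquiv, fun x y => ?_⟩
  · simp [h (e.symm x) (e.symm y)]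
  · simp
end Euclidean

/-! ### Quaternion coordinates. -/

open scoped InnerProductSpace

lemma quaternion_norm_sq (x : ℍ[ℝ]) :
    ‖x‖ ^ 2 = x.re ^ 2 + x.imI ^ 2 + x.imJ ^ 2 + x.imK ^ 2 := by
  rw [sq, ← Quaternion.normSq_eq_norm_mul_self, Quaternion.normSq_def']

lemma norm_eq_one_iff_sq (x : ℍ[ℝ]) :
    ‖x‖ = 1 ↔ x.re ^ 2 + x.imI ^ 2 + x.imJ ^ 2 + x.imK ^ 2 = 1 := by
  rw [← quaternion_norm_sq, pow_eq_one_iff_of_nonneg (norm_nonneg x) two_ne_zero]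

lemma star_mul_self_of_norm {x : ℍ[ℝ]} (h : ‖x‖ = 1) : star x * x = 1 := by
  rw [Quaternion.star_mul_self, Quaternion.normSq_eq_norm_mul_self, h]; simp

lemma self_mul_star_of_norm {x : ℍ[ℝ]} (h : ‖x‖ = 1) : x * star x = 1 := by
  rw [Quaternion.self_mul_star, Quaternion.normSq_eq_norm_mul_self, h]; simp

lemma quaternion_inner (x y : ℍ[ℝ]) :
    ⟪x, y⟫_ℝ = x.re * y.re + x.imI * y.imI + x.imJ * y.imJ + x.imK * y.imK := by
  rw [Quaternion.inner_def]; simp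

/-- The second quaternion unit. -/
def qj : ℍ[ℝ] := ⟨0, 0, 1, 0⟩

/-- The third quaternion unit. -/
def qk : ℍ[ℝ] := ⟨0, 0, 0, 1⟩

@[simp] lemma qi_re : qi.re = 0 := rfl
@[simp] lemma qi_imI : qi.imI = 1 := rfl
@[simp] lemma qi_imJ : qi.imJ = 0 := rfl
@[simp] lemma qi_imK : qi.imK = 0 := rfl
@[simp] lemma qj_re : qj.re = 0 := rfl
@[simp] lemma qj_imI : qj.imI = 0 := rfl
@[simp] lemma qj_imJ : qj.imJ = 1 := rfl
@[simp] lemma qj_imK : qj.imK = 0 := rfl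
@[simp] lemma qk_re : qk.re = 0 := rfl
@[simp] lemma qk_imI : qk.imI = 0 := rfl
@[simp] lemma qk_imJ : qk.imJ = 0 := rfl
@[simp] lemma qk_imK : qk.imK = 1 := rfl

lemma quaternion_decomp (x : ℍ[ℝ]) :
    x = x.re • (1 : ℍ[ℝ]) + x.imI • qi + x.imJ • qj + x.imK • qk := by
  ext <;> simp

lemma bilin_ext {n n' : ℍ[ℝ] →ₗ[ℝ] ℍ[ℝ] →ₗ[ℝ] ℍ[ℝ]} (h1 : ∀ y, n 1 y = n' 1 y)
    (h2 : ∀ x, n x 1 = n' x 1) (hii : n qi qi = n' qi qi) (hij : n qi qj = n' qi qj)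
    (hik : n qi qk = n' qi qk) (hji : n qj qi = n' qj qi) (hjj : n qj qj = n' qj qj)
    (hjk : n qj qk = n' qj qk) (hki : n qk qi = n' qk qi) (hkj : n qk qj = n' qk qj)
    (hkk : n qk qk = n' qk qk) : n = n' := by
  ext1 x
  ext1 y
  rw [quaternion_decomp x, quaternion_decomp y]
  simp only [map_add, map_smul, LinearMap.add_apply, LinearMap.smul_apply, h1, h2, hii, hij, hik,
    hji, hjj, hjk, hki, hkj, hkk]

/-! ### Unital composition products and Kaplansky's trick. -/

section Composition
variable {n : ℍ[ℝ] →ₗ[ℝ] ℍ[ℝ] →ₗ[ℝ] ℍ[ℝ]}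

lemma IsAbsoluteValued.inner_left (h : IsAbsoluteValued n) (x y w : ℍ[ℝ]) :
    ⟪n x y, n w y⟫_ℝ = ⟪x, w⟫_ℝ * ‖y‖ ^ 2 := by
  have h1 := norm_add_sq_real (n x y) (n w y)
  have h2 := norm_add_sq_real x w
  rw [← LinearMap.add_apply, ← map_add, h, h, h, mul_pow, h2] at h1
  linarith

lemma IsAbsoluteValued.inner_right (h : IsAbsoluteValued n) (x y z : ℍ[ℝ]) :
    ⟪n x y, n x z⟫_ℝ = ‖x‖ ^ 2 * ⟪y, z⟫_ℝ := by
  have h1 := norm_add_sq_real (n x y) (n x z)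
  have h2 := norm_add_sq_real y z
  rw [← map_add, h, h, h, mul_pow, h2] at h1
  linarith

lemma IsAbsoluteValued.inner_exchange (h : IsAbsoluteValued n) (x y z w : ℍ[ℝ]) :
    ⟪n x y, n w z⟫_ℝ + ⟪n x z, n w y⟫_ℝ = 2 * ⟪x, w⟫_ℝ * ⟪y, z⟫_ℝ := by
  have h1 := h.inner_left x (y + z) w
  rw [map_add, map_add, inner_add_left, inner_add_right, inner_add_right, h.inner_left,
    h.inner_left, norm_add_sq_real] at h1
  linarith

/-- A pure x is orthogonal to 1, so the exchange identity with w = 1 makes left multiplication by x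
skew. -/
lemma IsAbsoluteValued.inner_adjoint_left (h : IsAbsoluteValued n) (h1 : ∀ y, n 1 y = y)
    {x : ℍ[ℝ]} (hx : x.re = 0) (y z : ℍ[ℝ]) : ⟪n x y, z⟫_ℝ = -⟪y, n x z⟫_ℝ := by
  have h2 := h.inner_exchange x y z 1
  rw [h1, h1, quaternion_inner x 1] at h2
  simp only [hx, Quaternion.re_one, Quaternion.imI_one, Quaternion.imJ_one, Quaternion.imK_one] at h2
  rw [real_inner_comm (n x z) y]
  linarith

lemma IsAbsoluteValued.left_left (h : IsAbsoluteValued n) (h1 : ∀ y, n 1 y = y)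
    {x : ℍ[ℝ]} (hx : x.re = 0) (y : ℍ[ℝ]) : n x (n x y) = -(‖x‖ ^ 2 • y) := by
  refine ext_inner_right ℝ fun z => ?_
  rw [h.inner_adjoint_left h1 hx, h.inner_right, inner_neg_left, inner_smul_left]
  rfl

/-- The opposite of an absolute-valued product is absolute valued. -/
lemma IsAbsoluteValued.flip {A : Type*} [NormedAddCommGroup A] [NormedSpace ℝ A]
    {m : A →ₗ[ℝ] A →ₗ[ℝ] A} (h : IsAbsoluteValued m) : IsAbsoluteValued m.flip :=
  fun x y => by rw [LinearMap.flip_apply, h, mul_comm]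

lemma IsAbsoluteValued.right_right (h : IsAbsoluteValued n) (h1 : ∀ x, n x 1 = x)
    {x : ℍ[ℝ]} (hx : x.re = 0) (y : ℍ[ℝ]) : n (n y x) x = -(‖x‖ ^ 2 • y) :=
  h.flip.left_left h1 hx y

/-- Polarisation of x² = -‖x‖² at x + y. -/
lemma IsAbsoluteValued.anticomm (h : IsAbsoluteValued n) (h1 : ∀ y, n 1 y = y)
    (h2 : ∀ x, n x 1 = x) {x y : ℍ[ℝ]} (hx : x.re = 0) (hy : y.re = 0) (hxy : ⟪x, y⟫_ℝ = 0) :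
    n x y = -n y x := by
  rw [eq_neg_iff_add_eq_zero]
  have e1 := h.left_left h1 hx 1
  have e2 := h.left_left h1 hy 1
  have e3 := h.left_left h1 (x := x + y) (by simp [hx, hy]) 1
  rw [norm_add_sq_real, hxy, h2, map_add, map_add, LinearMap.add_apply, LinearMap.add_apply] at e3
  rw [h2] at e1 e2
  rw [e1, e2] at e3
  have : n x y + n y x = (-(‖x‖ ^ 2 • 1) + n y x + (n x y + -(‖y‖ ^ 2 • 1)))
      + (‖x‖ ^ 2 + ‖y‖ ^ 2) • (1 : ℍ[ℝ]) := by module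
  rw [this, e3]
  module

/-- In dimension four, a product with multiplicative norm whose unit is `1` is the quaternion
product or its opposite. -/
theorem IsAbsoluteValued.eq_mul_or_flip (h : IsAbsoluteValued n) (h1 : ∀ y, n 1 y = y)
    (h2 : ∀ x, n x 1 = x) : n = H ∨ n = H.flip := by
  have ni : ‖qi‖ = 1 := by rw [norm_eq_one_iff_sq]; simp [qi]
  have nj : ‖qj‖ = 1 := by rw [norm_eq_one_iff_sq]; simp [qj]
  have nk : ‖qk‖ = 1 := by rw [norm_eq_one_iff_sq]; simp [qk]
  have ri : qi.re = 0 := rfl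
  have rj : qj.re = 0 := rfl
  have rk : qk.re = 0 := rfl
  have hii : n qi qi = -1 := by simpa [h2, ni] using h.left_left h1 ri 1
  have hjj : n qj qj = -1 := by simpa [h2, nj] using h.left_left h1 rj 1
  have hkk : n qk qk = -1 := by simpa [h2, nk] using h.left_left h1 rk 1
  have hji : n qj qi = -n qi qj :=
    h.anticomm h1 h2 rj ri (by rw [quaternion_inner]; simp)
  have hki : n qk qi = -n qi qk :=
    h.anticomm h1 h2 rk ri (by rw [quaternion_inner]; simp)
  have hjk : n qj qk = -n qk qj :=
    h.anticomm h1 h2 rj rk (by rw [quaternion_inner]; simp)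
  have hn : ‖n qi qj‖ = 1 := by rw [h, ni, nj, one_mul]
  -- The product of i and j is orthogonal to 1, i and j, hence is ±k; the sign decides between ℍ and
  -- its opposite.
  have o1 := h.inner_adjoint_left h1 ri qj 1
  have o2 := h.inner_right qi qj 1
  have o3 := h.inner_left qi qj 1
  rw [norm_eq_one_iff_sq] at hn
  simp only [h1, h2, quaternion_inner] at o1 o2 o3
  simp at o1 o2 o3
  have hij : ∃ t : ℝ, t ^ 2 = 1 ∧ n qi qj = t • qk := by
    refine ⟨(n qi qj).imK, ?_, ?_⟩
    · rw [o1, o2, o3] at hn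
      linarith
    · ext <;> simp [o1, o2, o3]
  obtain ⟨t, ht, hij⟩ := hij
  have hk : qk = t • n qi qj := by rw [hij, smul_smul, ← sq, ht, one_smul]
  have hik : n qi qk = -t • qj := by
    rw [hk, map_smul, h.left_left h1 ri, ni, one_pow, one_smul, smul_neg, neg_smul]
  have hkj : n qk qj = -t • qi := by
    rw [hk, map_smul, LinearMap.smul_apply, h.right_right h2 rj, nj, one_pow, one_smul, smul_neg, neg_smul]
  rcases (by simpa using ht : t = 1 ∨ t = -1) with rfl | rfl
  · left
    refine bilin_ext (by simp [h1, H]) (by simp [h2, H]) ?_ ?_ ?_ ?_ ?_ ?_ ?_ ?_ ?_ <;>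
    simp only [hii, hjj, hkk, hji, hki, hjk, hij, hik, hkj, H, LinearMap.mk₂_apply] <;>
    ext <;> simp
  · right
    refine bilin_ext (by simp [h1, H]) (by simp [h2, H]) ?_ ?_ ?_ ?_ ?_ ?_ ?_ ?_ ?_ <;>
    simp only [hii, hjj, hkk, hji, hki, hjk, hij, hik, hkj, H, LinearMap.mk₂_apply,
      LinearMap.flip_apply] <;>
    ext <;> simp

/-- An absolute-valued product on `ℍ` is `S x * T y` or `T y * S x` for isometries `S`, `T`. -/
theorem IsAbsoluteValued.exists_isometries (h : IsAbsoluteValued n) :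
    ∃ S T : ℍ[ℝ] ≃ₗᵢ[ℝ] ℍ[ℝ], (∀ x y, n x y = S x * T y) ∨ (∀ x y, n x y = T y * S x) := by
  have hone : ‖(1 : ℍ[ℝ])‖ = 1 := norm_one
  set e := n 1 1 with he
  have hne : ‖e‖ = 1 := by rw [he, h, hone, one_mul]
  let M : ℍ[ℝ] ≃ₗᵢ[ℝ] ℍ[ℝ] := LinearIsometry.toLinearIsometryEquiv
    ⟨LinearMap.mulLeft ℝ e, fun x => by simp [hne]⟩ rfl
  have hM (x) : M x = e * x := rfl
  have hMs (x) : M.symm x = star e * x := by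
    rw [LinearIsometryEquiv.symm_apply_eq, hM, ← mul_assoc, self_mul_star_of_norm hne, one_mul]
  let R := h.right 1 hone
  let L := h.left 1 hone
  have hR (x) : R x = n x 1 := rfl
  have hL (x) : L x = n 1 x := rfl
  -- Kaplansky's isotope R⁻¹x · L⁻¹y has unit e = 1 · 1; transport along `M` moves that unit to 1.
  let n' : ℍ[ℝ] →ₗ[ℝ] ℍ[ℝ] →ₗ[ℝ] ℍ[ℝ] :=
    LinearMap.mk₂ ℝ (fun x y => M.symm (n (R.symm (M x)) (L.symm (M y)))) (by simp) (by simp)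
      (by simp) (by simp)
  have hn' (x y) : n' x y = M.symm (n (R.symm (M x)) (L.symm (M y))) := rfl
  have hav : IsAbsoluteValued n' := fun x y => by
    rw [hn', LinearIsometryEquiv.norm_map, h]; simp
  have hRe : R.symm (M 1) = 1 := by rw [LinearIsometryEquiv.symm_apply_eq, hM, hR, mul_one]
  have hLe : L.symm (M 1) = 1 := by rw [LinearIsometryEquiv.symm_apply_eq, hM, hL, mul_one]
  have hn (x y) : n x y = e * n' (M.symm (R x)) (M.symm (L y)) := by
    rw [← hM, hn']; simp
  have := hav.eq_mul_or_flip (fun y => by rw [hn', hRe, ← hL]; simp)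
    (fun x => by rw [hn', hLe, ← hR]; simp)
  rcases this with h' | h'
  · refine ⟨(R.trans M.symm).trans M, L.trans M.symm, Or.inl fun x y => ?_⟩
    rw [hn, h']
    simp [H, hM, mul_assoc]
  · refine ⟨R.trans M.symm, (L.trans M.symm).trans M, Or.inr fun x y => ?_⟩
    rw [hn, h']
    simp [H, hM, mul_assoc]

end Composition

/-! ### Isometries of ℍ. -/

section Orthogonal

lemma reflection_quaternion (u x : ℍ[ℝ]) (hu : ‖u‖ = 1) :
    (ℝ ∙ u)ᗮ.reflection x = (-u) * star x * u := by
  rw [Submodule.reflection_orthogonal_apply, Submodule.reflection_singleton_apply, hu]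
  have h := (norm_eq_one_iff_sq u).1 hu
  rw [quaternion_inner]
  rw [two_smul]
  ext
  · simp; linear_combination (-x.re) * h
  · simp; linear_combination (-x.imI) * h
  · simp; linear_combination (-x.imJ) * h
  · simp; linear_combination (-x.imK) * h

/-- Every isometry of the space of quaternions is `x ↦ p x q` or `x ↦ p x̄ q` with norm-one `p`,
`q`. -/
theorem isometry_quaternion (S : ℍ[ℝ] ≃ₗᵢ[ℝ] ℍ[ℝ]) :
    ∃ p q : ℍ[ℝ], ‖p‖ = 1 ∧ ‖q‖ = 1 ∧
      ((∀ x, S x = p * x * q) ∨ (∀ x, S x = p * star x * q)) := by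
  -- Cartan–Dieudonné: it suffices to treat reflections and closure under the group operations.
  have hS : S ∈ Subgroup.closure (Set.range fun v : ℍ[ℝ] => (ℝ ∙ v)ᗮ.reflection) := by
    rw [LinearIsometryEquiv.reflections_generate]; trivial
  induction hS using Subgroup.closure_induction with
  | mem S hS =>
    obtain ⟨v, rfl⟩ := hS
    rcases eq_or_ne v 0 with rfl | hv
    · refine ⟨1, 1, by simp, by simp, Or.inl fun x => ?_⟩
      simp [Submodule.reflection_mem_subspace_eq_self]
    · have hn : ‖‖v‖⁻¹ • v‖ = 1 := by
        rw [norm_smul, norm_inv, norm_norm, inv_mul_cancel₀ (norm_ne_zero_iff.2 hv)]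
      have hs : (ℝ ∙ v) = (ℝ ∙ (‖v‖⁻¹ • v)) :=
        (Submodule.span_singleton_smul_eq (by simpa using hv) v).symm
      refine ⟨-(‖v‖⁻¹ • v), ‖v‖⁻¹ • v, by rw [norm_neg, hn], hn, Or.inr fun x => ?_⟩
      have := reflection_quaternion (‖v‖⁻¹ • v) x hn
      simp only [← hs] at this
      exact this
  | one => exact ⟨1, 1, by simp, by simp, Or.inl fun x => by simp⟩
  | mul S T _ _ hS hT =>
    obtain ⟨p, q, hp, hq, h⟩ := hS
    obtain ⟨p', q', hp', hq', h'⟩ := hT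
    rcases h with h | h <;> rcases h' with h' | h'
    · exact ⟨p * p', q' * q, by simp [*], by simp [*], Or.inl fun x => by simp [h, h', mul_assoc]⟩
    · exact ⟨p * p', q' * q, by simp [*], by simp [*], Or.inr fun x => by simp [h, h', mul_assoc]⟩
    · exact ⟨p * star q', star p' * q, by simp [*], by simp [*],
        Or.inr fun x => by simp [h, h', mul_assoc]⟩
    · exact ⟨p * star q', star p' * q, by simp [*], by simp [*],
        Or.inl fun x => by simp [h, h', mul_assoc]⟩
  | inv S _ hS =>
    obtain ⟨p, q, hp, hq, h⟩ := hS
    have key : ∀ y x, S y = x → S⁻¹ x = y := fun y x hyx => by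
      rw [← hyx]; exact S.symm_apply_apply y
    rcases h with h | h
    · refine ⟨star p, star q, by simp [*], by simp [*], Or.inl fun x => key _ _ ?_⟩
      rw [h]
      calc p * (star p * x * star q) * q = (p * star p) * x * (star q * q) := by noncomm_ring
        _ = x := by rw [self_mul_star_of_norm hp, star_mul_self_of_norm hq]; simp
    · refine ⟨q, p, by simp [*], by simp [*], Or.inr fun x => key _ _ ?_⟩
      rw [h]
      calc p * star (q * star x * p) * q = (p * star p) * x * (star q * q) := by
            simp [mul_assoc]
        _ = x := by rw [self_mul_star_of_norm hp, star_mul_self_of_norm hq]; simp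

end Orthogonal

/-! ### Invariance under isomorphism and passage to the opposite. -/

section Isomorphism

lemma Isomorphic.refl {A : Type*} [AddCommGroup A] [Module ℝ A] (m : A →ₗ[ℝ] A →ₗ[ℝ] A) :
    Isomorphic m m :=
  ⟨LinearEquiv.refl ℝ A, fun _ _ => rfl⟩

variable {A B C : Type*} [AddCommGroup A] [Module ℝ A] [AddCommGroup B] [Module ℝ B]
  [AddCommGroup C] [Module ℝ C] {m : A →ₗ[ℝ] A →ₗ[ℝ] A} {n : B →ₗ[ℝ] B →ₗ[ℝ] B}
  {k : C →ₗ[ℝ] C →ₗ[ℝ] C}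

lemma Isomorphic.symm (h : Isomorphic m n) : Isomorphic n m := by
  obtain ⟨f, hf⟩ := h
  exact ⟨f.symm, fun x y => by
    rw [LinearEquiv.symm_apply_eq, hf, f.apply_symm_apply, f.apply_symm_apply]⟩

lemma Isomorphic.trans (h : Isomorphic m n) (h' : Isomorphic n k) : Isomorphic m k := by
  obtain ⟨f, hf⟩ := h
  obtain ⟨g, hg⟩ := h'
  exact ⟨f.trans g, fun x y => by simp [hf, hg]⟩

lemma Isomorphic.flip (h : Isomorphic m n) : Isomorphic m.flip n.flip := by
  obtain ⟨f, hf⟩ := h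
  exact ⟨f, fun x y => hf y x⟩

lemma Isomorphic.satisfiesSqSqSq (h : Isomorphic m n) (hm : SatisfiesSqSqSq m) :
    SatisfiesSqSqSq n := by
  obtain ⟨f, hf⟩ := h.symm
  intro x
  apply f.injective
  have := hm (f x)
  simp only [assoc, map_sub, hf, map_zero] at this ⊢
  exact this

lemma SatisfiesSqSqSq.flip (hm : SatisfiesSqSqSq m) : SatisfiesSqSqSq m.flip := by
  intro x
  have := hm x
  simp only [assoc, LinearMap.flip_apply, sub_eq_zero] at this ⊢
  exact this.symm

lemma isomorphic_neg {m n : A →ₗ[ℝ] A →ₗ[ℝ] A} (h : ∀ x y, n x y = -m x y) : Isomorphic m n :=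
  ⟨LinearEquiv.neg ℝ, fun x y => by simp [h]⟩

end Isomorphism

/-! ### The four principal isotopes. -/

/-- The linear equivalence `x ↦ p x q` for norm-one `p`, `q`. -/
noncomputable def sandwich {p q : ℍ[ℝ]} (hp : ‖p‖ = 1) (hq : ‖q‖ = 1) : ℍ[ℝ] ≃ₗ[ℝ] ℍ[ℝ] where
  toFun x := p * x * q
  invFun x := star p * x * star q
  map_add' x y := by simp [mul_add, add_mul]
  map_smul' t x := by simp
  left_inv x := by
    calc star p * (p * x * q) * star q = (star p * p) * x * (q * star q) := by simp only [mul_assoc]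
      _ = x := by rw [star_mul_self_of_norm hp, self_mul_star_of_norm hq]; simp
  right_inv x := by
    calc p * (star p * x * star q) * q = (p * star p) * x * (star q * q) := by simp only [mul_assoc]
      _ = x := by rw [self_mul_star_of_norm hp, star_mul_self_of_norm hq]; simp

@[simp] lemma sandwich_apply {p q : ℍ[ℝ]} (hp : ‖p‖ = 1) (hq : ‖q‖ = 1) (x : ℍ[ℝ]) :
    sandwich hp hq x = p * x * q := rfl

/-- Quaternion conjugation as a linear isometry equivalence. -/
noncomputable def conjIsometry : ℍ[ℝ] ≃ₗᵢ[ℝ] ℍ[ℝ] where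
  toFun := star
  invFun := star
  map_add' x y := star_add x y
  map_smul' t x := by simp
  left_inv := star_star
  right_inv := star_star
  norm_map' x := Quaternion.norm_star x

@[simp] lemma conjIsometry_apply (x : ℍ[ℝ]) : conjIsometry x = star x := rfl

@[simp] lemma starH_apply (a b x y : ℍ[ℝ]) : starH a b x y = star x * a * y * b := rfl

@[simp] lemma Hstar_apply (a b x y : ℍ[ℝ]) : Hstar a b x y = a * x * b * star y := rfl

@[simp] lemma H_apply (x y : ℍ[ℝ]) : H x y = x * y := rfl

@[simp] lemma starHstar_apply (x y : ℍ[ℝ]) : starHstar x y = star x * star y := rfl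

/-- The product `a x y b`. -/
noncomputable def twistedH (a b : ℍ[ℝ]) : ℍ[ℝ] →ₗ[ℝ] ℍ[ℝ] →ₗ[ℝ] ℍ[ℝ] :=
  LinearMap.mk₂ ℝ (fun x y => a * x * y * b)
    (by intros; simp [mul_add, add_mul]) (by intros; simp)
    (by intros; simp [mul_add, add_mul]) (by intros; simp)

/-- The product `a x̄ ȳ b`. -/
noncomputable def twistedStarHstar (a b : ℍ[ℝ]) : ℍ[ℝ] →ₗ[ℝ] ℍ[ℝ] →ₗ[ℝ] ℍ[ℝ] :=
  LinearMap.mk₂ ℝ (fun x y => a * star x * star y * b)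
    (by intros; simp [mul_add, add_mul]) (by intros; simp)
    (by intros; simp [mul_add, add_mul]) (by intros; simp)

@[simp] lemma twistedH_apply (a b x y : ℍ[ℝ]) : twistedH a b x y = a * x * y * b := rfl

@[simp] lemma twistedStarHstar_apply (a b x y : ℍ[ℝ]) :
    twistedStarHstar a b x y = a * star x * star y * b := rfl

lemma mul_star_cancel_left {p : ℍ[ℝ]} (hp : ‖p‖ = 1) (x : ℍ[ℝ]) : p * (star p * x) = x := by
  rw [← mul_assoc, self_mul_star_of_norm hp, one_mul]

lemma star_mul_cancel_left {p : ℍ[ℝ]} (hp : ‖p‖ = 1) (x : ℍ[ℝ]) : star p * (p * x) = x := by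
  rw [← mul_assoc, star_mul_self_of_norm hp, one_mul]

/-- Isotopes of `ℍ` by isometries, up to isomorphism. -/
lemma exists_principal_of_isometries {n : ℍ[ℝ] →ₗ[ℝ] ℍ[ℝ] →ₗ[ℝ] ℍ[ℝ]} (S T : ℍ[ℝ] ≃ₗᵢ[ℝ] ℍ[ℝ])
    (h : ∀ x y, n x y = S x * T y) :
    ∃ a b : ℍ[ℝ], ‖a‖ = 1 ∧ ‖b‖ = 1 ∧ (Isomorphic n (twistedH a b) ∨ Isomorphic n (starH a b) ∨
      Isomorphic n (Hstar a b) ∨ Isomorphic n (twistedStarHstar a b)) := by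
  obtain ⟨p, q, hp, hq, hS⟩ := isometry_quaternion S
  obtain ⟨r, s, hr, hs, hT⟩ := isometry_quaternion T
  have hc : ‖q * r‖ = 1 := by simp [hq, hr]
  have h1 : ‖(1 : ℍ[ℝ])‖ = 1 := norm_one
  -- In each case multiplication on one side by a unit built from p, q, r, s is the isomorphism; it
  -- reduces the three remaining unit factors to two.
  rcases hS with hS | hS <;> rcases hT with hT | hT
  · refine ⟨p, star (q * r) * s * (q * r), hp, by simp [hq, hr, hs], Or.inl
      ⟨sandwich h1 hc, fun x y => ?_⟩⟩
    simp [h, hS, hT, mul_assoc, mul_star_cancel_left hr, mul_star_cancel_left hq]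
  · refine ⟨star s * p * s, q * r, by simp [hp, hs], hc, Or.inr <| Or.inr <| Or.inl
      ⟨sandwich (p := star s) (q := 1) (by simp [hs]) h1, fun x y => ?_⟩⟩
    simp [h, hS, hT, mul_assoc, mul_star_cancel_left hs]
  · refine ⟨q * r, p * s * star p, hc, by simp [hp, hs], Or.inr <| Or.inl
      ⟨sandwich (p := 1) (q := star p) h1 (by simp [hp]), fun x y => ?_⟩⟩
    simp [h, hS, hT, mul_assoc, star_mul_cancel_left hp]
  · refine ⟨p * star (q * r), s * star (q * r), by simp [hp, hq, hr], by simp [hs, hq, hr],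
      Or.inr <| Or.inr <| Or.inr
      ⟨sandwich (p := 1) (q := star (q * r)) h1 (by simp [hq, hr]), fun x y => ?_⟩⟩
    simp [h, hS, hT, mul_assoc, star_mul_cancel_left hr, star_mul_cancel_left hq]

/-- Every absolute-valued product on `ℍ` is isomorphic to one of the four principal isotopes. -/
theorem IsAbsoluteValued.exists_principal {n : ℍ[ℝ] →ₗ[ℝ] ℍ[ℝ] →ₗ[ℝ] ℍ[ℝ]}
    (h : IsAbsoluteValued n) :
    ∃ a b : ℍ[ℝ], ‖a‖ = 1 ∧ ‖b‖ = 1 ∧ (Isomorphic n (twistedH a b) ∨ Isomorphic n (starH a b) ∨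
      Isomorphic n (Hstar a b) ∨ Isomorphic n (twistedStarHstar a b)) := by
  obtain ⟨S, T, hST | hST⟩ := h.exists_isometries
  · exact exists_principal_of_isometries S T hST
  -- Conjugation reverses quaternion products, so transport along it restores the order of the
  -- factors.
  · let n' : ℍ[ℝ] →ₗ[ℝ] ℍ[ℝ] →ₗ[ℝ] ℍ[ℝ] :=
      LinearMap.mk₂ ℝ (fun x y => star (n (star x) (star y))) (by simp) (by simp) (by simp)
        (by simp)
    have hn : Isomorphic n n' := ⟨conjIsometry.toLinearEquiv, fun x y => by simp [n']⟩
    obtain ⟨a, b, ha, hb, hab⟩ := exists_principal_of_isometries (n := n')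
      ((conjIsometry.trans S).trans conjIsometry) ((conjIsometry.trans T).trans conjIsometry)
      (fun x y => by simp [n', hST])
    refine ⟨a, b, ha, hb, ?_⟩
    rcases hab with hab | hab | hab | hab
    · exact Or.inl (hn.trans hab)
    · exact Or.inr <| Or.inl (hn.trans hab)
    · exact Or.inr <| Or.inr <| Or.inl (hn.trans hab)
    · exact Or.inr <| Or.inr <| Or.inr (hn.trans hab)

/-! ### Conjugacy into ℂ and square roots. -/

@[simp] lemma expi_re (α : ℝ) : (expi α).re = Real.cos α := rfl
@[simp] lemma expi_imI (α : ℝ) : (expi α).imI = Real.sin α := rfl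
@[simp] lemma expi_imJ (α : ℝ) : (expi α).imJ = 0 := rfl
@[simp] lemma expi_imK (α : ℝ) : (expi α).imK = 0 := rfl

lemma norm_qi : ‖qi‖ = 1 := by rw [norm_eq_one_iff_sq]; simp
lemma norm_qj : ‖qj‖ = 1 := by rw [norm_eq_one_iff_sq]; simp
lemma norm_expi (α : ℝ) : ‖expi α‖ = 1 := by rw [norm_eq_one_iff_sq]; simp

/-- Every quaternion is conjugate to a complex number in the closed upper half plane. -/
lemma exists_conj_complex (b : ℍ[ℝ]) :
    ∃ p : ℍ[ℝ], ‖p‖ = 1 ∧ ∃ t : ℝ, 0 ≤ t ∧ t ^ 2 = b.imI ^ 2 + b.imJ ^ 2 + b.imK ^ 2 ∧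
      p * b = (Quaternion.coeComplex ⟨b.re, t⟩) * p := by
  set r := Real.sqrt (b.imI ^ 2 + b.imJ ^ 2 + b.imK ^ 2) with hr
  have hr0 : 0 ≤ r := Real.sqrt_nonneg _
  have hr2 : r ^ 2 = b.imI ^ 2 + b.imJ ^ 2 + b.imK ^ 2 := Real.sq_sqrt (by positivity)
  obtain ⟨P, hP, hPb⟩ : ∃ P : ℍ[ℝ], P ≠ 0 ∧ P * b = (Quaternion.coeComplex ⟨b.re, r⟩) * P := by
    -- With v = Im b, both v and ri square to -r², so P = ri + v satisfies Pv = (ri)P. It vanishes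
    -- only if v = -ri, and then j works.
    by_cases hz : r + b.imI = 0 ∧ b.imJ = 0 ∧ b.imK = 0
    · obtain ⟨h1, h2, h3⟩ := hz
      have h1 : r = -b.imI := by linarith
      refine ⟨qj, fun h => by simpa using congrArg (fun x : ℍ[ℝ] => x.imJ) h, ?_⟩
      ext <;> simp [h1, h2, h3]
    · refine ⟨(r + b.imI) • qi + b.imJ • qj + b.imK • qk, fun h => hz ?_, ?_⟩
      · have h1 := congrArg (fun x : ℍ[ℝ] => x.imI) h
        have h2 := congrArg (fun x : ℍ[ℝ] => x.imJ) h
        have h3 := congrArg (fun x : ℍ[ℝ] => x.imK) h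
        simp at h1 h2 h3
        exact ⟨h1, h2, h3⟩
      · ext
        · simp; linear_combination hr2
        · simp; ring
        · simp; ring
        · simp; ring
  refine ⟨‖P‖⁻¹ • P, ?_, r, hr0, hr2, ?_⟩
  · rw [norm_smul, norm_inv, norm_norm, inv_mul_cancel₀ (norm_ne_zero_iff.2 hP)]
  · rw [smul_mul_assoc, hPb, mul_smul_comm]

/-- Conjugate q into ℂ and take a complex root there. -/
lemma exists_mul_self (q : ℍ[ℝ]) : ∃ x : ℍ[ℝ], x * x = q := by
  obtain ⟨p, hp, t, -, -, h⟩ := exists_conj_complex q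
  obtain ⟨w, hw⟩ := IsAlgClosed.exists_pow_nat_eq (⟨q.re, t⟩ : ℂ) (n := 2) two_pos
  refine ⟨star p * w * p, ?_⟩
  have : star p * (p * q) = q := star_mul_cancel_left hp q
  rw [← this, h, ← hw, sq, Quaternion.coeComplex_mul]
  simp only [mul_assoc, mul_star_cancel_left hp]

lemma eq_one_or_neg_one {a : ℍ[ℝ]} (ha : ‖a‖ = 1) (h1 : a.imI = 0) (h2 : a.imJ = 0)
    (h3 : a.imK = 0) : a = 1 ∨ a = -1 := by
  rw [norm_eq_one_iff_sq, h1, h2, h3] at ha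
  have : a.re = 1 ∨ a.re = -1 := by
    rw [← sq_eq_one_iff]; linarith
  rcases this with h | h
  · left; ext <;> simp [*]
  · right; ext <;> simp [*]

/-! ### The identity for a x y b and a x̄ ȳ b. -/

/-- The condition on `a`, `b` expressing third-power associativity of `a x y b`. -/
lemma eq_one_or_neg_one_of_commute {a b : ℍ[ℝ]} (ha : ‖a‖ = 1) (hb : ‖b‖ = 1)
    (h : ∀ s : ℍ[ℝ], a * (s * s) * b * s = s * (a * (s * s) * b)) :
    (a = 1 ∨ a = -1) ∧ (b = 1 ∨ b = -1) := by
  have hcomm : ∀ s t : ℍ[ℝ], s * t = t * s →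
      s.imI * t.imJ = s.imJ * t.imI ∧ s.imI * t.imK = s.imK * t.imI ∧
        s.imJ * t.imK = s.imK * t.imJ := by
    intro s t hst
    have h1 := congrArg (fun x : ℍ[ℝ] => x.imI) hst
    have h2 := congrArg (fun x : ℍ[ℝ] => x.imJ) hst
    have h3 := congrArg (fun x : ℍ[ℝ] => x.imK) hst
    simp at h1 h2 h3
    refine ⟨?_, ?_, ?_⟩ <;> linarith
  have hii : qi * qi = -1 := by ext <;> simp
  have hjj : qj * qj = -1 := by ext <;> simp
  -- Taking s = i and s = j, whose squares are -1, shows that ab commutes with i and j, so it is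
  -- real.
  obtain ⟨t, ht⟩ : ∃ t : ℝ, a * b = (t : ℍ[ℝ]) := by
    refine ⟨(a * b).re, ?_⟩
    have e1 := h qi
    have e2 := h qj
    rw [hii, mul_neg, mul_one, neg_mul, neg_mul, mul_neg, neg_inj] at e1
    rw [hjj, mul_neg, mul_one, neg_mul, neg_mul, mul_neg, neg_inj] at e2
    generalize a * b = c at e1 e2
    have h1 := hcomm _ _ e1
    have h2 := hcomm _ _ e2
    simp at h1 h2
    ext
    · simp
    · simp [h2]
    · simp [← h1.1]
    · simp [← h1.2]
  have hbt : b = t • star a := by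
    rw [← star_mul_cancel_left ha b, ht, Quaternion.mul_coe_eq_smul]
  have ht0 : t ≠ 0 := by
    rintro rfl
    rw [hbt, zero_smul, norm_zero] at hb
    exact zero_ne_one hb
  have h' (s : ℍ[ℝ]) : a * (s * s) * star a * s = s * (a * (s * s) * star a) := by
    have := h s
    rw [hbt, mul_smul_comm, smul_mul_assoc, mul_smul_comm] at this
    exact smul_right_injective _ ht0 this
  -- These s say that the rotation v ↦ a v ā preserves the lines through i, j, i + j and j + k. Such
  -- a rotation is trivial, so a is real.
  have c1 := hcomm _ _ (h' (1 + qi))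
  have c2 := hcomm _ _ (h' (1 + qj))
  have c4 := hcomm _ _ (h' (1 + qi + qj))
  have c5 := hcomm _ _ (h' (1 + qj + qk))
  clear h h' hcomm
  simp at c1 c2 c4 c5
  have p12 : a.imI * a.imJ = 0 := by linarith [c1.1, c2.1]
  have s12 : a.imI ^ 2 = a.imJ ^ 2 := by nlinarith [c4.1]
  have s23 : a.imJ ^ 2 = a.imK ^ 2 := by nlinarith [c5.2]
  have z1 : a.imI = 0 ∧ a.imJ = 0 := by
    rcases mul_eq_zero.1 p12 with h | h
    · exact ⟨h, by rwa [h, zero_pow two_ne_zero, eq_comm, sq_eq_zero_iff] at s12⟩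
    · exact ⟨by rwa [h, zero_pow two_ne_zero, sq_eq_zero_iff] at s12, h⟩
  have z3 : a.imK = 0 := by simpa [z1.2] using s23.symm
  refine ⟨eq_one_or_neg_one ha z1.1 z1.2 z3, eq_one_or_neg_one hb ?_ ?_ ?_⟩ <;>
    simp [hbt, z1.1, z1.2, z3]

/-- A product `a x y b` satisfying the identity is isomorphic to `ℍ`. -/
theorem isomorphic_H_of_twistedH {a b : ℍ[ℝ]} (ha : ‖a‖ = 1) (hb : ‖b‖ = 1)
    (h : SatisfiesSqSqSq (twistedH a b)) : Isomorphic (twistedH a b) H := by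
  have key : ∀ s : ℍ[ℝ], a * (s * s) * b * s = s * (a * (s * s) * b) := by
    intro s
    obtain ⟨x, hx⟩ := exists_mul_self (star a * s * star b)
    have e := h x
    have hs : twistedH a b x x = s := by
      rw [twistedH_apply, mul_assoc a, hx]
      simp only [mul_assoc, star_mul_self_of_norm hb, mul_one, mul_star_cancel_left ha]
    rw [assoc, hs, sub_eq_zero] at e
    simp only [twistedH_apply] at e
    have ha0 : a ≠ 0 := norm_ne_zero_iff.1 (by rw [ha]; exact one_ne_zero)
    have hb0 : b ≠ 0 := norm_ne_zero_iff.1 (by rw [hb]; exact one_ne_zero)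
    apply mul_left_cancel₀ ha0
    apply mul_right_cancel₀ hb0
    simpa only [mul_assoc] using e
  rcases eq_one_or_neg_one_of_commute ha hb key with ⟨rfl | rfl, rfl | rfl⟩
  · exact ⟨LinearEquiv.refl ℝ _, fun x y => by simp⟩
  · exact isomorphic_neg fun x y => by simp
  · exact isomorphic_neg fun x y => by simp
  · exact ⟨LinearEquiv.refl ℝ _, fun x y => by simp⟩

/-- A product `a x̄ ȳ b` satisfying the identity is isomorphic to the standard one. -/
theorem isomorphic_starHstar_of_twisted {a b : ℍ[ℝ]} (ha : ‖a‖ = 1) (hb : ‖b‖ = 1)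
    (h : SatisfiesSqSqSq (twistedStarHstar a b)) :
    Isomorphic (twistedStarHstar a b) starHstar := by
  have ha' : ‖star a‖ = 1 := by rw [norm_star, ha]
  have hb' : ‖star b‖ = 1 := by rw [norm_star, hb]
  have key : ∀ s : ℍ[ℝ], star b * (s * s) * star a * s = s * (star b * (s * s) * star a) := by
    intro s
    obtain ⟨x, hx⟩ := exists_mul_self (star (star a * s * star b))
    have e := h x
    have hs : twistedStarHstar a b x x = s := by
      rw [twistedStarHstar_apply, mul_assoc a, ← star_mul, hx, star_star]
      simp only [mul_assoc, star_mul_self_of_norm hb, mul_one, mul_star_cancel_left ha]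
    rw [assoc, hs, sub_eq_zero] at e
    simp only [twistedStarHstar_apply] at e
    have ha0 : a ≠ 0 := norm_ne_zero_iff.1 (by rw [ha]; exact one_ne_zero)
    have hb0 : b ≠ 0 := norm_ne_zero_iff.1 (by rw [hb]; exact one_ne_zero)
    have e' : (star b * (s * s) * star a) * star s = star s * (star b * (s * s) * star a) := by
      apply mul_left_cancel₀ ha0
      apply mul_right_cancel₀ hb0
      simpa only [star_mul, star_star, mul_assoc] using e
    -- Since s + s̄ is real, commuting with s̄ amounts to commuting with s.
    have hs : s = ((2 * s.re : ℝ) : ℍ[ℝ]) - star s := by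
      ext
      · simp; ring
      all_goals simp
    generalize star b * (s * s) * star a = c at e'
    rw [hs, mul_sub, sub_mul, e', Quaternion.coe_commutes]
  obtain ⟨hb1, ha1⟩ := eq_one_or_neg_one_of_commute hb' ha' key
  have hstar : ∀ c : ℍ[ℝ], (star c = 1 ∨ star c = -1) → c = 1 ∨ c = -1 := by
    rintro c (h | h)
    · left; rw [← star_star c, h, star_one]
    · right; rw [← star_star c, h, star_neg, star_one]
  rcases hstar a ha1 with rfl | rfl <;> rcases hstar b hb1 with rfl | rfl
  · exact ⟨LinearEquiv.refl ℝ _, fun x y => by simp⟩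
  · exact isomorphic_neg fun x y => by simp
  · exact isomorphic_neg fun x y => by simp
  · exact ⟨LinearEquiv.refl ℝ _, fun x y => by simp⟩

/-! ### The identity for x̄ a y b. -/

lemma starH_conj {p a b a' b' : ℍ[ℝ]} (hp : ‖p‖ = 1) (ha : p * a = a' * p) (hb : p * b = b' * p) :
    Isomorphic (starH a b) (starH a' b') := by
  refine ⟨sandwich (p := p) (q := star p) hp (by simp [hp]), fun x y => ?_⟩
  have ha' : a = star p * a' * p := by rw [mul_assoc, ← ha, star_mul_cancel_left hp]
  have hb' : b = star p * b' * p := by rw [mul_assoc, ← hb, star_mul_cancel_left hp]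
  simp [ha', hb', mul_assoc, self_mul_star_of_norm hp]

lemma starH_neg_left (a b : ℍ[ℝ]) : Isomorphic (starH a b) (starH (-a) b) :=
  isomorphic_neg fun x y => by simp

lemma starH_neg_right (a b : ℍ[ℝ]) : Isomorphic (starH a b) (starH a (-b)) :=
  isomorphic_neg fun x y => by simp

/-- Conjugation is an anti-automorphism of ℍ; this reduces every question about `Hstar` to `starH`.
-/
lemma Hstar_flip (a b : ℍ[ℝ]) : Isomorphic (Hstar a b).flip (starH (star b) (star a)) :=
  ⟨conjIsometry.toLinearEquiv, fun x y => by simp [mul_assoc]⟩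

/-- The identity for `*ℍ(a, b)` in terms of the conjugates `c` of `a`. -/
lemma SatisfiesSqSqSq.conj_identity {a b c : ℍ[ℝ]} (ha : ‖a‖ = 1) (hb : ‖b‖ = 1)
    (h : SatisfiesSqSqSq (starH a b)) (hre : c.re = a.re) (hc : ‖c‖ = 1) :
    star b * star c * star a * c * b * a * c = star c * a * star b * star c * a * c * b := by
  obtain ⟨p, hp, t, ht, ht2, hpa⟩ := exists_conj_complex a
  obtain ⟨q, hq, u, hu, hu2, hqc⟩ := exists_conj_complex c
  have hut : u = t := by
    rw [norm_eq_one_iff_sq] at ha hc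
    rw [hre] at hc
    exact (sq_eq_sq₀ hu ht).1 (by linarith)
  -- Equal real part and norm make a and c conjugate to the same complex number, so c = x̄ a x for x
  -- = p̄q.
  have hs : starH a b (star p * q) (star p * q) = c * b := by
    rw [hre, hut] at hqc
    have : c = star q * (q * c) := (star_mul_cancel_left hq c).symm
    rw [this, hqc]
    have : Quaternion.coeComplex ⟨a.re, t⟩ = p * a * star p := by
      rw [hpa, mul_assoc, self_mul_star_of_norm hp, mul_one]
    rw [this]
    simp [mul_assoc]
  have e := h (star p * q)
  rw [assoc, hs, sub_eq_zero] at e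
  simp only [starH_apply, star_mul, star_star] at e
  have hb0 : b ≠ 0 := norm_ne_zero_iff.1 (by rw [hb]; exact one_ne_zero)
  have hsb0 : star b ≠ 0 := by simpa using hb0
  apply mul_left_cancel₀ hsb0
  apply mul_right_cancel₀ hb0
  apply mul_right_cancel₀ hb0
  simpa only [mul_assoc] using e

lemma imJ_imK_eq_zero_of_commute {b : ℍ[ℝ]} {p q : ℝ} (hq : q ≠ 0)
    (h : b * Quaternion.coeComplex ⟨p, q⟩ = Quaternion.coeComplex ⟨p, q⟩ * b) :
    b.imJ = 0 ∧ b.imK = 0 := by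
  have h1 := congrArg (fun x : ℍ[ℝ] => x.imJ) h
  have h2 := congrArg (fun x : ℍ[ℝ] => x.imK) h
  simp at h1 h2
  exact ⟨mul_left_cancel₀ hq (by linarith), mul_left_cancel₀ hq (by linarith)⟩

lemma eq_coeComplex {b : ℍ[ℝ]} (h : b.imJ = 0 ∧ b.imK = 0) :
    b = Quaternion.coeComplex ⟨b.re, b.imI⟩ := by
  ext <;> simp [h.1, h.2]

/-- In `*ℍ(a, b)` with the identity and complex `a`, `a` is real or purely imaginary. -/
lemma re_eq_zero_or_im_eq_zero {p q : ℝ} {b : ℍ[ℝ]} (ha : p ^ 2 + q ^ 2 = 1) (hb : ‖b‖ = 1)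
    (h : SatisfiesSqSqSq (starH (Quaternion.coeComplex ⟨p, q⟩) b)) : p = 0 ∨ q = 0 := by
  by_contra! hpq
  obtain ⟨hp, hq⟩ := hpq
  have hna : ‖Quaternion.coeComplex ⟨p, q⟩‖ = 1 := by
    rw [norm_eq_one_iff_sq]; simp; linarith
  -- Taking c = a shows that b commutes with a², which is not real when pq ≠ 0; so b is complex and
  -- commutes with a. Then c = ā yields a⁴ = 1.
  have e1 := h.conj_identity hna hb rfl hna
  have e2 := h.conj_identity (c := star (Quaternion.coeComplex ⟨p, q⟩)) hna hb (by simp)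
    (by rw [norm_star, hna])
  set a := Quaternion.coeComplex ⟨p, q⟩ with hadef
  have haa' := self_mul_star_of_norm hna
  have hbb := star_mul_self_of_norm hb
  have hcomm : b * (a * a) = (a * a) * b := by
    simp only [mul_assoc, star_mul_cancel_left hna] at e1
    have := congrArg (fun x => a * (b * x)) e1
    simpa only [mul_star_cancel_left hb, mul_star_cancel_left hna, mul_assoc] using this
  have hb2 : b.imJ = 0 ∧ b.imK = 0 := by
    rw [hadef, ← Quaternion.coeComplex_mul, Complex.mk_mul_mk] at hcomm
    refine imJ_imK_eq_zero_of_commute ?_ hcomm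
    have := mul_ne_zero hp hq
    contrapose! this
    linarith
  have hab : a * b = b * a := by
    rw [eq_coeComplex hb2, hadef, ← Quaternion.coeComplex_mul, mul_comm,
      Quaternion.coeComplex_mul]
  have hsab : star b * a = a * star b := by
    have := congrArg (fun x => star b * x * star b) hab
    simp only [mul_assoc, self_mul_star_of_norm hb, star_mul_cancel_left hb, mul_one] at this
    exact this
  have hsab' : star b * star a = star a * star b := by rw [← star_mul, hab, star_mul]
  have h4 : a * a * (a * a) = 1 := by
    simp only [star_star, mul_assoc, haa', mul_one] at e2
    rw [← mul_assoc, hsab', mul_assoc, hbb, mul_one,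
      ← mul_assoc (star b), hsab, mul_assoc a (star b), hbb, mul_one] at e2
    rw [mul_assoc, ← e2, haa']
  have h5 := congrArg (fun x : ℍ[ℝ] => x.re) h4
  have h6 := congrArg (fun x : ℍ[ℝ] => x.imI) h4
  simp [hadef] at h5 h6
  -- The imaginary part of a⁴ = 1 forces p² = q² = 1/2, but then a⁴ = -1.
  have h7 : p * q * (p ^ 2 - q ^ 2) = 0 := by linarith
  have h8 : p ^ 2 - q ^ 2 = 0 := (mul_eq_zero.1 h7).resolve_left (mul_ne_zero hp hq)
  have h9 : q * q = 1 / 2 := by linarith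
  have h10 : p * p = 1 / 2 := by linarith
  have h11 : p * q * (p * q) = 1 / 4 := by linear_combination (p * p) * h9 + 1 / 2 * h10
  rw [h9, h10] at h5
  linarith

/-- In `*ℍ(i, b)` with the identity, `b` is one of `± 1`, `± i`. -/
lemma eq_of_starH_qi {b : ℍ[ℝ]} (hb : ‖b‖ = 1) (h : SatisfiesSqSqSq (starH qi b)) :
    (b = 1 ∨ b = -1) ∨ (b = qi ∨ b = -qi) := by
  have E (x y z : ℝ) (hxyz : x ^ 2 + y ^ 2 + z ^ 2 = 1) :=
    h.conj_identity (c := x • qi + y • qj + z • qk) norm_qi hb (by simp)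
      (by rw [norm_eq_one_iff_sq]; simp; linarith)
  have hn := (norm_eq_one_iff_sq b).1 hb
  have R (x y z : ℝ) (hxyz : x ^ 2 + y ^ 2 + z ^ 2 = 1) :=
    congrArg (fun c : ℍ[ℝ] => c.re) (E x y z hxyz)
  -- At rational points c of the sphere of conjugates of i, the real part of the identity is a
  -- quadratic relation in the coordinates of b. Linear combinations isolate `f3` and `f5`, which
  -- kill the j and k coordinates, and `f4`, which leaves b real or a multiple of i.
  have c1 := R 0 1 0 (by norm_num)
  have c2 := R 0 0 1 (by norm_num)
  have c3 := R (3 / 5) (4 / 5) 0 (by norm_num)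
  have c4 := R (3 / 5) 0 (4 / 5) (by norm_num)
  have c5 := R (1 / 3) (2 / 3) (2 / 3) (by norm_num)
  clear E R
  simp at c1 c2 c3 c4 c5
  ring_nf at c1 c2 c3 c4 c5
  have f1 : b.imJ * b.re + b.imK * b.imI = 0 := by linarith
  have f2 : b.imK * b.re - b.imJ * b.imI = 0 := by linarith
  have f3 : b.imJ * b.imK = 0 := by linarith
  have f4 : b.re * b.imI = 0 := by linarith
  have f5 : b.imJ ^ 2 = b.imK ^ 2 := by linarith
  have f6 : (b.re ^ 2 + b.imI ^ 2) * (b.imJ ^ 2 + b.imK ^ 2) = 0 := by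
    linear_combination (b.imJ * b.re + b.imK * b.imI) * f1 + (b.imK * b.re - b.imJ * b.imI) * f2
  have f7 : b.imJ = 0 ∧ b.imK = 0 := by
    have f8 : b.imJ = 0 ∨ b.imK = 0 := mul_eq_zero.1 f3
    rcases f8 with h0 | h0
    · exact ⟨h0, by rwa [h0, zero_pow two_ne_zero, eq_comm, sq_eq_zero_iff] at f5⟩
    · exact ⟨by rwa [h0, zero_pow two_ne_zero, sq_eq_zero_iff] at f5, h0⟩
  rcases mul_eq_zero.1 f4 with h0 | h0
  · right
    rw [h0, f7.1, f7.2] at hn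
    have : b.imI = 1 ∨ b.imI = -1 := by rw [← sq_eq_one_iff]; linarith
    rcases this with h1 | h1
    · left; ext <;> simp [h0, h1, f7.1, f7.2]
    · right; ext <;> simp [h0, h1, f7.1, f7.2]
  · exact Or.inl (eq_one_or_neg_one hb h0 f7.1 f7.2)

/-- The products `*ℍ(a, b)` of the list. -/
def starList : Set (ℍ[ℝ] →ₗ[ℝ] ℍ[ℝ] →ₗ[ℝ] ℍ[ℝ]) :=
  {m | m = starH qi 1 ∨ m = starH qi qi ∨ ∃ α ∈ Set.Ico (0 : ℝ) Real.pi, m = starH 1 (expi α)}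

/-- A product `*ℍ(a, b)` satisfying the identity is isomorphic to one of the list. -/
theorem exists_starList {a b : ℍ[ℝ]} (ha : ‖a‖ = 1) (hb : ‖b‖ = 1)
    (h : SatisfiesSqSqSq (starH a b)) : ∃ n ∈ starList, Isomorphic (starH a b) n := by
  obtain ⟨p, hp, t, ht, ht2, hpa⟩ := exists_conj_complex a
  have hpb : p * b = (p * b * star p) * p := by
    rw [mul_assoc (p * b), star_mul_self_of_norm hp, mul_one]
  have hiso := starH_conj hp hpa hpb
  have hb' : ‖p * b * star p‖ = 1 := by simp [hp, hb]
  have h' := hiso.satisfiesSqSqSq h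
  rw [norm_eq_one_iff_sq] at ha
  have hat : a.re ^ 2 + t ^ 2 = 1 := by linarith
  generalize p * b * star p = b' at *
  suffices H : ∃ n ∈ starList,
      Isomorphic (starH (Quaternion.coeComplex ⟨a.re, t⟩) b') n by
    obtain ⟨n, hn, hn'⟩ := H
    exact ⟨n, hn, hiso.trans hn'⟩
  clear hiso
  rcases re_eq_zero_or_im_eq_zero hat hb' h' with h0 | h0
  · have ht1 : t = 1 := by
      rw [h0] at hat
      nlinarith
    have hqi : Quaternion.coeComplex ⟨a.re, t⟩ = qi := by ext <;> simp [h0, ht1]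
    rw [hqi] at h' ⊢
    rcases eq_of_starH_qi hb' h' with (rfl | rfl) | (rfl | rfl)
    · exact ⟨_, Or.inl rfl, Isomorphic.refl _⟩
    · exact ⟨_, Or.inl rfl, (starH_neg_right _ _).symm⟩
    · exact ⟨_, Or.inr (Or.inl rfl), Isomorphic.refl _⟩
    · exact ⟨_, Or.inr (Or.inl rfl), (starH_neg_right _ _).symm⟩
  · have hone : Isomorphic (starH (Quaternion.coeComplex ⟨a.re, t⟩) b') (starH 1 b') := by
      rcases eq_one_or_neg_one (a := Quaternion.coeComplex ⟨a.re, t⟩)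
        (by rw [norm_eq_one_iff_sq]; simpa using hat) (by simpa using h0) rfl rfl with h1 | h1
      · rw [h1]; exact Isomorphic.refl _
      · rw [h1]; exact (starH_neg_left _ _).symm
    obtain ⟨q, hq, u, hu, hu2, hqb⟩ := exists_conj_complex b'
    have hiso : Isomorphic (starH 1 b') (starH 1 (Quaternion.coeComplex ⟨b'.re, u⟩)) :=
      starH_conj hq (by simp) hqb
    rw [norm_eq_one_iff_sq] at hb'
    have hru : b'.re ^ 2 + u ^ 2 = 1 := by linarith
    have hr1 : -1 ≤ b'.re := by nlinarith
    have hr2 : b'.re ≤ 1 := by nlinarith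
    have hexp : Quaternion.coeComplex ⟨b'.re, u⟩ = expi (Real.arccos b'.re) := by
      have : u = Real.sqrt (1 - b'.re ^ 2) := by
        rw [eq_comm, Real.sqrt_eq_iff_mul_self_eq] <;> nlinarith
      ext <;> simp [Real.cos_arccos hr1 hr2, Real.sin_arccos, this]
    -- The angle π lies outside the half-open range; there b' is conjugate to -1, and a sign change
    -- gives α = 0.
    rcases eq_or_lt_of_le (Real.arccos_le_pi b'.re) with h2 | h2
    · refine ⟨starH 1 (expi 0), Or.inr (Or.inr ⟨0, ⟨le_rfl, Real.pi_pos⟩, rfl⟩),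
        hone.trans (hiso.trans ?_)⟩
      have : expi (Real.arccos b'.re) = -expi 0 := by
        rw [h2]; ext <;> simp
      rw [hexp, this]
      exact (starH_neg_right _ _).symm
    · refine ⟨_, Or.inr (Or.inr ⟨_, ⟨Real.arccos_nonneg _, h2⟩, rfl⟩), hone.trans ?_⟩
      rwa [hexp] at hiso

/-! ### Opposites, and the identity for the listed algebras. -/

lemma starH_one_star_expi (α : ℝ) :
    Isomorphic (starH 1 (star (expi α))) (starH 1 (expi α)) :=
  starH_conj norm_qj (by simp) (by ext <;> simp)

/-- The opposites of the products `*ℍ(a, b)` of the list are the products `ℍ*(a, b)`. -/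
lemma exists_flip_of_mem_starList {n : ℍ[ℝ] →ₗ[ℝ] ℍ[ℝ] →ₗ[ℝ] ℍ[ℝ]} (hn : n ∈ starList) :
    ∃ n' ∈ algebraList, Isomorphic n.flip n' := by
  have hsi : star qi = -qi := by ext <;> simp
  rcases hn with rfl | rfl | ⟨α, hα, rfl⟩
  · refine ⟨Hstar 1 qi, by simp [algebraList], ?_⟩
    have h1 := Hstar_flip 1 qi
    rw [star_one, hsi] at h1
    exact (h1.trans (starH_neg_left qi 1).symm).symm.flip
  · refine ⟨Hstar qi qi, by simp [algebraList], ?_⟩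
    have h1 := Hstar_flip qi qi
    rw [hsi] at h1
    exact (h1.trans ((starH_neg_left qi (-qi)).symm.trans
      (starH_neg_right qi qi).symm)).symm.flip
  · refine ⟨Hstar (expi α) 1, Or.inr ⟨α, hα, Or.inr rfl⟩, ?_⟩
    have h1 := Hstar_flip (expi α) 1
    rw [star_one] at h1
    exact (h1.trans (starH_one_star_expi α)).symm.flip

lemma starList_subset : starList ⊆ algebraList := by
  rintro n (rfl | rfl | ⟨α, hα, rfl⟩)
  · simp [algebraList]
  · simp [algebraList]
  · exact Or.inr ⟨α, hα, Or.inl rfl⟩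

/-- The products `*ℍ(a, b)` of the list satisfy the identity. -/
lemma satisfiesSqSqSq_of_mem_starList {n : ℍ[ℝ] →ₗ[ℝ] ℍ[ℝ] →ₗ[ℝ] ℍ[ℝ]} (hn : n ∈ starList) :
    SatisfiesSqSqSq n := by
  have hsi : star qi = -qi := by ext <;> simp
  have hii : qi * qi = -1 := by ext <;> simp
  -- When a = i, squares are c or ci with c = x̄ i x pure, so c̄ = -c and c² is real.
  have him (x : ℍ[ℝ]) : star (star x * qi * x) = -(star x * qi * x) := by
    simp [hsi, mul_assoc]
  have hsq (c : ℍ[ℝ]) (hc : star c = -c) : ∃ r : ℝ, c * c = r :=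
    ⟨-Quaternion.normSq c, by
      rw [Quaternion.coe_neg, ← Quaternion.star_mul_self, hc, neg_mul, neg_neg]⟩
  intro x
  rcases hn with rfl | rfl | ⟨α, hα, rfl⟩
  · have hs : starH qi 1 x x = star x * qi * x := by simp
    rw [assoc, hs, sub_eq_zero]
    have hc := him x
    generalize star x * qi * x = c at hc
    simp [hc, hsi, mul_assoc]
  · have hs : starH qi qi x x = star x * qi * x * qi := by simp
    rw [assoc, hs, sub_eq_zero]
    have hc := him x
    generalize star x * qi * x = c at hc
    obtain ⟨r, hr⟩ := hsq c hc
    have hr' (y : ℍ[ℝ]) : c * (c * y) = r • y := by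
      rw [← mul_assoc, hr, Quaternion.coe_mul_eq_smul]
    have hii' (y : ℍ[ℝ]) : qi * (qi * y) = -y := by rw [← mul_assoc, hii, neg_one_mul]
    simp [hc, hsi, mul_assoc, hii, hr', hii']
  -- Here every square is a real multiple of the idempotent e^{iα}.
  · have hs : starH 1 (expi α) x x = Quaternion.normSq x • expi α := by
      rw [starH_apply, mul_one, Quaternion.star_mul_self, Quaternion.coe_mul_eq_smul]
    have he : starH 1 (expi α) (expi α) (expi α) = expi α := by
      rw [starH_apply, mul_one, star_mul_self_of_norm (norm_expi α), one_mul]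
    rw [assoc, hs]
    simp [he, -starH_apply]

/-- The algebras of the list satisfy the identity. -/
theorem satisfiesSqSqSq_of_mem_algebraList {n : ℍ[ℝ] →ₗ[ℝ] ℍ[ℝ] →ₗ[ℝ] ℍ[ℝ]}
    (hn : n ∈ algebraList) : SatisfiesSqSqSq n := by
  have hflip (a b : ℍ[ℝ]) (h : SatisfiesSqSqSq (starH (star b) (star a))) :
      SatisfiesSqSqSq (Hstar a b) := ((Hstar_flip a b).symm.satisfiesSqSqSq h).flip
  have hsi : star qi = -qi := by ext <;> simp
  rcases hn with (rfl | rfl | rfl | rfl | rfl | rfl) | ⟨α, hα, rfl | rfl⟩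
  · intro x
    simp [assoc, mul_assoc]
  · intro x
    generalize starHstar x x = s
    have hs : star s * s = s * star s := star_comm_self' s
    rw [assoc, sub_eq_zero]
    simp only [starHstar_apply, star_mul, star_star]
    rw [mul_assoc, ← hs, ← mul_assoc, ← hs, mul_assoc]
  · exact satisfiesSqSqSq_of_mem_starList (Or.inl rfl)
  · exact satisfiesSqSqSq_of_mem_starList (Or.inr (Or.inl rfl))
  · apply hflip
    rw [star_one, hsi]
    exact (starH_neg_left _ _).satisfiesSqSqSq (satisfiesSqSqSq_of_mem_starList (Or.inl rfl))
  · apply hflip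
    rw [hsi]
    exact ((starH_neg_left _ _).trans (starH_neg_right _ _)).satisfiesSqSqSq
      (satisfiesSqSqSq_of_mem_starList (Or.inr (Or.inl rfl)))
  · exact satisfiesSqSqSq_of_mem_starList (Or.inr (Or.inr ⟨α, hα, rfl⟩))
  · apply hflip
    rw [star_one]
    exact (starH_one_star_expi α).symm.satisfiesSqSqSq
      (satisfiesSqSqSq_of_mem_starList (Or.inr (Or.inr ⟨α, hα, rfl⟩)))

/-! ### Infinitely many isomorphism classes. -/

/-- The trace of left multiplication by the idempotent of `*ℍ(1, e^{iα})`. -/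
lemma trace_starH_expi (α : ℝ) :
    LinearMap.trace ℝ ℍ[ℝ] (starH 1 (expi α) (expi α)) = 4 * Real.cos α ^ 2 := by
  let B : Module.Basis (Fin 4) ℝ ℍ[ℝ] := QuaternionAlgebra.basisOneIJK (-1) 0 (-1)
  have hB (x : ℍ[ℝ]) : ⇑(B.repr x) = ![x.re, x.imI, x.imJ, x.imK] := rfl
  have h0 : B 0 = 1 := by
    rw [Module.Basis.apply_eq_iff]; ext j; rw [hB]; fin_cases j <;> simp
  have h1 : B 1 = qi := by
    rw [Module.Basis.apply_eq_iff]; ext j; rw [hB]; fin_cases j <;> simp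
  have h2 : B 2 = qj := by
    rw [Module.Basis.apply_eq_iff]; ext j; rw [hB]; fin_cases j <;> simp
  have h3 : B 3 = qk := by
    rw [Module.Basis.apply_eq_iff]; ext j; rw [hB]; fin_cases j <;> simp
  rw [LinearMap.trace_eq_matrix_trace ℝ B]
  simp only [Matrix.trace, Fin.sum_univ_four, Matrix.diag_apply, LinearMap.toMatrix_apply, hB, h0,
    h1, h2, h3]
  simp
  ring

/-- The cosine of `α` is determined up to sign by the isomorphism class of `*ℍ(1, e^{iα})`. -/
lemma cos_sq_eq_of_isomorphic {α β : ℝ}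
    (h : Isomorphic (starH 1 (expi α)) (starH 1 (expi β))) : Real.cos α ^ 2 = Real.cos β ^ 2 := by
  obtain ⟨f, hf⟩ := h
  -- A nonzero idempotent z of the target satisfies z = ‖z‖² e^{iβ}; taking norms gives ‖z‖ = 1, so
  -- z = e^{iβ}.
  have he : f (expi α) = expi β := by
    have h1 := hf (expi α) (expi α)
    rw [starH_apply, starH_apply, mul_one, mul_one, star_mul_self_of_norm (norm_expi α), one_mul,
      Quaternion.star_mul_self, Quaternion.coe_mul_eq_smul] at h1
    have hne : f (expi α) ≠ 0 := by
      rw [ne_eq, f.map_eq_zero_iff]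
      exact norm_ne_zero_iff.1 (by rw [norm_expi]; exact one_ne_zero)
    have h2 := congrArg norm h1
    rw [norm_smul, norm_expi, mul_one, Quaternion.normSq_eq_norm_mul_self, norm_mul, norm_norm] at h2
    have h3 : ‖f (expi α)‖ = 1 :=
      (mul_left_cancel₀ (norm_ne_zero_iff.2 hne) (by rw [← h2, mul_one])).symm
    rwa [Quaternion.normSq_eq_norm_mul_self, h3, one_mul, one_smul] at h1
  have hconj : f.conj (starH 1 (expi α) (expi α)) = starH 1 (expi β) (expi β) := by
    ext1 y
    rw [LinearEquiv.conj_apply_apply, hf, he, f.apply_symm_apply]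
  have h1 := trace_starH_expi β
  rw [← hconj, LinearMap.trace_conj', trace_starH_expi] at h1
  linarith

/-- The list represents infinitely many isomorphism classes. -/
theorem infinite_isoClass : (isoClass '' algebraList).Infinite := by
  -- On [0, π/2) the cosine is nonnegative and injective, so cos² separates the angles.
  refine Set.infinite_of_injOn_mapsTo (s := Set.Ico (0 : ℝ) (Real.pi / 2))
    (f := fun α => isoClass (starH 1 (expi α))) ?_ ?_ (Set.Ico_infinite (by positivity))
  · intro α hα β hβ h
    have hiso : Isomorphic (starH 1 (expi α)) (starH 1 (expi β)) := Quotient.exact h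
    have hpi := Real.pi_pos
    refine Real.injOn_cos ⟨hα.1, by linarith [hα.2]⟩ ⟨hβ.1, by linarith [hβ.2]⟩ ?_
    refine (sq_eq_sq₀ ?_ ?_).1 (cos_sq_eq_of_isomorphic hiso)
    · exact Real.cos_nonneg_of_mem_Icc ⟨by linarith [hα.1], hα.2.le⟩
    · exact Real.cos_nonneg_of_mem_Icc ⟨by linarith [hβ.1], hβ.2.le⟩
  · intro α hα
    refine ⟨_, Or.inr ⟨α, ⟨hα.1, ?_⟩, Or.inl rfl⟩, rfl⟩
    have := hα.2
    linarith [Real.pi_pos]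

/-- An absolute-valued product on `ℍ` with the identity is isomorphic to one of the list. -/
theorem IsAbsoluteValued.exists_algebraList {n : ℍ[ℝ] →ₗ[ℝ] ℍ[ℝ] →ₗ[ℝ] ℍ[ℝ]}
    (h : IsAbsoluteValued n) (hn : SatisfiesSqSqSq n) : ∃ k ∈ algebraList, Isomorphic n k := by
  obtain ⟨a, b, ha, hb, hab | hab | hab | hab⟩ := h.exists_principal
  · exact ⟨H, by simp [algebraList],
      hab.trans (isomorphic_H_of_twistedH ha hb (hab.satisfiesSqSqSq hn))⟩
  · obtain ⟨k, hk, hk'⟩ := exists_starList ha hb (hab.satisfiesSqSqSq hn)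
    exact ⟨k, starList_subset hk, hab.trans hk'⟩
  · have h1 := (hab.flip.trans (Hstar_flip a b))
    obtain ⟨k, hk, hk'⟩ := exists_starList (a := star b) (b := star a) (by rw [norm_star, hb])
      (by rw [norm_star, ha]) (h1.satisfiesSqSqSq hn.flip)
    obtain ⟨k', hk1, hk2⟩ := exists_flip_of_mem_starList hk
    exact ⟨k', hk1, ((h1.trans hk').flip).trans hk2⟩
  · exact ⟨starHstar, by simp [algebraList],
      hab.trans (isomorphic_starHstar_of_twisted ha hb (hab.satisfiesSqSqSq hn))⟩

end AbsoluteValued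

theorem theorem3p23 :
    (∀ (A : Type*) [NormedAddCommGroup A] [NormedSpace ℝ A] (m : A →ₗ[ℝ] A →ₗ[ℝ] A),
      AbsoluteValued.IsAbsoluteValued m → Module.finrank ℝ A = 4 →
        (AbsoluteValued.SatisfiesSqSqSq m ↔
          ∃ n ∈ AbsoluteValued.algebraList, AbsoluteValued.Isomorphic m n)) ∧
    (AbsoluteValued.isoClass '' AbsoluteValued.algebraList).Infinite := by
  refine ⟨fun A _ _ m hm hd => ⟨fun h => ?_, ?_⟩, AbsoluteValued.infinite_isoClass⟩
  · obtain ⟨n, hn, hmn⟩ := hm.exists_quaternion hd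
    obtain ⟨k, hk, hnk⟩ := hn.exists_algebraList (hmn.satisfiesSqSqSq h)
    exact ⟨k, hk, hmn.trans hnk⟩
  · rintro ⟨n, hn, hmn⟩
    exact hmn.symm.satisfiesSqSqSq (AbsoluteValued.satisfiesSqSqSq_of_mem_algebraList hn)
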